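/- For a complex Banach space $X$ let $\rho_X(\tau)=\sup\{\tfrac12(\|x+\tau y\|+\|x-\tau y\|)-1 : \|x\|=\|y\|=1\}$ ($\tau>0$, $\sup\emptyset=0$) be its modulus of uniform smoothness; $X$ is uniformly smooth if $\rho_X(\tau)/\tau\to0$ as $\tau\to0^+$. A norm $\|\cdot\|_X$ on the space $M_n$ of complex $n\times n$ matrices is unitarily invariant if $\|UAV\|_X=\|A\|_X$ for all $A\in M_n$ and all unitary $U,V\in M_n$. For such a norm that is uniformly smooth, write $X=(M_n,\|\cdot\|_X)$ and let $J_X:X\to X^*$ be the duality map: $J_X(A)$ is the unique functional with norm $\|A\|_X$ whose value at $A$ is $\|A\|_X^2$, regarded as a matrix through the trace duality $\langle B,C\rangle=\operatorname{tr}(BC)$. Put $G(A)=|J_X(A)|\,A$, where $|B|=(B^*B)^{1/2}$, and $\|A\|_1=\operatorname{tr}|A|$. (a) $G$ is uniformly continuous from the unit sphere of $X$ to $S_1^n=(M_n,\|\cdot\|_1)$, with a modulus of continuity depending only on the modulus of uniform smoothness of $X$ (and not otherwise on $n$ or $X$). Precisely: for every function $\rho$ with $\rho(\tau)/\tau\to0$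 as $\tau\to0^+$ there is a function $\omega:[0,\infty)\to\mathbb{R}$ with $\omega(t)\to\omega(0)=0$ as $t\to0^+$ such that, for every $n$ and every uniformly smooth unitarily invariant norm $X$ on $M_n$ with $\rho_X(\tau)\le\rho(\tau)$ for all $\tau>0$, $$\|G(A)-G(B)\|_1\le\omega(\|A-B\|_X)\qquad\text{whenever }\|A\|_X=\|B\|_X=1 .$$ (b) If $X$ is a uniformly smooth unitarily invariant norm on $M_n$ and $A\in M_n$ is positive semidefinite with $\|A\|_X=1$, then $G(A)$ is a state: it is positive semidefinite and $\|G(A)\|_1=\operatorname{tr}G(A)=1$. -/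

import Mathlib

open Filter Topology
open scoped MatrixOrder ComplexOrder

noncomputable section

/-- The modulus of (uniform) smoothness of a normed space,
`ρ_E(τ) = sup {(‖x + τ y‖ + ‖x - τ y‖) / 2 - 1 : ‖x‖ = ‖y‖ = 1}`. -/
def modulusOfSmoothness (E : Type*) [NormedAddCommGroup E] [NormedSpace ℝ E] (τ : ℝ) : ℝ :=
  sSup {r : ℝ | ∃ x y : E, ‖x‖ = 1 ∧ ‖y‖ = 1 ∧
    r = (‖x + τ • y‖ + ‖x - τ • y‖) / 2 - 1}

/-- `E` is uniformly smooth: `ρ_E(τ) / τ → 0` as `τ → 0⁺`. -/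
def UniformlySmooth (E : Type*) [NormedAddCommGroup E] [NormedSpace ℝ E] : Prop :=
  Tendsto (fun τ : ℝ => modulusOfSmoothness E τ / τ) (𝓝[>] 0) (𝓝 0)

theorem le_modulusOfSmoothness {E : Type*} [NormedAddCommGroup E] [NormedSpace ℝ E] {x y : E}
    (hx : ‖x‖ = 1) (hy : ‖y‖ = 1) (τ : ℝ) :
    (‖x + τ • y‖ + ‖x - τ • y‖) / 2 - 1 ≤ modulusOfSmoothness E τ := by
  refine le_csSup ⟨|τ|, ?_⟩ ⟨x, y, hx, hy, rfl⟩
  rintro r ⟨a, b, ha, hb, rfl⟩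
  have h1 := norm_add_le a (τ • b)
  have h2 := norm_sub_le a (τ • b)
  rw [norm_smul, ha, hb, Real.norm_eq_abs] at h1 h2
  linarith

section Duality

variable {E : Type*} [NormedAddCommGroup E] [NormedSpace ℂ E]

/-- `f` is a value of the duality map at `x`: `‖f‖ = ‖x‖` and `f x = ‖x‖ ^ 2`. -/
def IsDualityValue (x : E) (f : StrongDual ℂ E) : Prop :=
  ‖f‖ = ‖x‖ ∧ f x = ((‖x‖ ^ 2 : ℝ) : ℂ)

theorem exists_isDualityValue (x : E) : ∃ f : StrongDual ℂ E, IsDualityValue x f := by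
  by_cases hx : x = 0
  · exact ⟨0, by simp [IsDualityValue, hx]⟩
  · obtain ⟨g, hg, hgx⟩ := exists_dual_vector ℂ x (norm_ne_zero_iff.mpr hx)
    refine ⟨(‖x‖ : ℂ) • g, ?_, ?_⟩
    · rw [norm_smul, hg]; simp
    · simp [hgx, pow_two]

/-- The duality map `J_E : E → E*`. On a smooth space (in particular on a uniformly smooth one,
see `IsDualityValue.eq_dualityMap`) its value is the unique `f` with `‖f‖ = ‖x‖` and
`f x = ‖x‖ ^ 2`. -/
def dualityMap (x : E) : StrongDual ℂ E := (exists_isDualityValue x).choose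

theorem isDualityValue_dualityMap (x : E) : IsDualityValue x (dualityMap x) :=
  (exists_isDualityValue x).choose_spec

/-- On a uniformly smooth space the value of the duality map is uniquely determined. -/
theorem IsDualityValue.eq_dualityMap [NormedSpace ℝ E] [IsScalarTower ℝ ℂ E]
    (hE : UniformlySmooth E) {x : E} {f : StrongDual ℂ E} (hf : IsDualityValue x f) :
    f = dualityMap x := by
  have main : ∀ (x : E) (f g : StrongDual ℂ E), IsDualityValue x f → IsDualityValue x g →
      ∀ y : E, ‖x‖ = 1 → ‖y‖ = 1 → (f y - g y).re ≤ 0 := by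
    intro x f g hf hg y hx hy
    have hlim : Tendsto (fun τ : ℝ => 2 * (modulusOfSmoothness E τ / τ)) (𝓝[>] 0) (𝓝 0) := by
      simpa using hE.const_mul (2 : ℝ)
    refine ge_of_tendsto hlim ?_
    filter_upwards [self_mem_nhdsWithin] with τ hτ
    have hτ' : (0 : ℝ) < τ := hτ
    have hb : ∀ (h : StrongDual ℂ E), IsDualityValue x h → ∀ z : E, (h z).re ≤ ‖z‖ := by
      intro h hh z
      calc (h z).re ≤ ‖h z‖ := Complex.re_le_norm _
        _ ≤ ‖h‖ * ‖z‖ := h.le_opNorm z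
        _ = ‖z‖ := by rw [hh.1, hx, one_mul]
    have hsm : ∀ (h : StrongDual ℂ E), (h (τ • y)).re = τ * (h y).re := by
      intro h
      rw [← algebraMap_smul ℂ τ y, map_smul]
      simp
    have h1 := hb f hf (x + τ • y)
    have h2 := hb g hg (x - τ • y)
    have hfx : (f x).re = 1 := by rw [hf.2, hx]; simp
    have hgx : (g x).re = 1 := by rw [hg.2, hx]; simp
    rw [map_add, Complex.add_re, hsm, hfx] at h1
    rw [map_sub, Complex.sub_re, hsm, hgx] at h2
    have h3 := le_modulusOfSmoothness hx hy τ
    rw [Complex.sub_re, ← mul_div_assoc, le_div_iff₀ hτ']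
    nlinarith
  have hg := isDualityValue_dualityMap x
  by_cases hx : x = 0
  · subst hx
    have h1 : f = 0 := norm_eq_zero.mp (by rw [hf.1, norm_zero])
    have h2 : dualityMap (0 : E) = 0 := norm_eq_zero.mp (by rw [hg.1, norm_zero])
    rw [h1, h2]
  have hx0 : ‖x‖ ≠ 0 := norm_ne_zero_iff.mpr hx
  have hxc : (‖x‖ : ℂ) ≠ 0 := by exact_mod_cast hx0
  have hscale : ∀ h : StrongDual ℂ E, IsDualityValue x h →
      IsDualityValue ((‖x‖ : ℂ)⁻¹ • x) ((‖x‖ : ℂ)⁻¹ • h) := by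
    intro h hh
    have hn : ‖(‖x‖ : ℂ)⁻¹ • x‖ = 1 := by
      rw [norm_smul]; simp [hx0]
    refine ⟨?_, ?_⟩
    · rw [hn, norm_smul, hh.1]; simp [hx0]
    · rw [hn, smul_apply, map_smul, hh.2]
      simp only [smul_eq_mul]
      push_cast
      field_simp
  have hn : ‖(‖x‖ : ℂ)⁻¹ • x‖ = 1 := by
    rw [norm_smul]; simp [hx0]
  have key : ∀ y : E, ‖y‖ = 1 → (f y - dualityMap x y).re ≤ 0 := by
    intro y hy
    have h := main _ _ _ (hscale f hf) (hscale _ hg) y hn hy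
    have hpos : 0 < ‖x‖ := norm_pos_iff.mpr hx
    have he : ((‖x‖ : ℂ)⁻¹ • f) y - ((‖x‖ : ℂ)⁻¹ • dualityMap x) y
        = ((‖x‖⁻¹ : ℝ) : ℂ) * (f y - dualityMap x y) := by
      simp [mul_sub]
    rw [he, Complex.re_ofReal_mul] at h
    by_contra hcon
    push Not at hcon
    have := mul_pos (inv_pos.mpr hpos) hcon
    linarith
  ext y
  rw [← sub_eq_zero]
  by_contra hne
  have hy : y ≠ 0 := by
    rintro rfl
    simp at hne
  set d : ℂ := f y - dualityMap x y with hd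
  have hy0 : (‖y‖ : ℂ) ≠ 0 := by exact_mod_cast norm_ne_zero_iff.mpr hy
  have hdn : ‖d‖ ≠ 0 := norm_ne_zero_iff.mpr hne
  have hz : ‖(((‖d‖ : ℂ)⁻¹ * (starRingEnd ℂ) d) * (‖y‖ : ℂ)⁻¹) • y‖ = 1 := by
    rw [norm_smul]
    simp [hdn, norm_ne_zero_iff.mpr hy]
  have h := key _ hz
  have he : f ((((‖d‖ : ℂ)⁻¹ * (starRingEnd ℂ) d) * (‖y‖ : ℂ)⁻¹) • y)
      - dualityMap x ((((‖d‖ : ℂ)⁻¹ * (starRingEnd ℂ) d) * (‖y‖ : ℂ)⁻¹) • y)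
      = ((‖d‖ * ‖y‖⁻¹ : ℝ) : ℂ) := by
    rw [map_smul, map_smul, ← smul_sub, ← hd, smul_eq_mul]
    have : (starRingEnd ℂ) d * d = (‖d‖ : ℂ) ^ 2 := by
      rw [mul_comm, Complex.mul_conj']
    have hdc : (‖d‖ : ℂ) ≠ 0 := by exact_mod_cast hdn
    calc (‖d‖ : ℂ)⁻¹ * (starRingEnd ℂ) d * (‖y‖ : ℂ)⁻¹ * d
        = (‖d‖ : ℂ)⁻¹ * (‖y‖ : ℂ)⁻¹ * ((starRingEnd ℂ) d * d) := by ring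
      _ = _ := by
        rw [this]
        push_cast
        field_simp
  rw [he, Complex.ofReal_re] at h
  have : 0 < ‖d‖ * ‖y‖⁻¹ :=
    mul_pos (norm_pos_iff.mpr hne) (inv_pos.mpr (norm_pos_iff.mpr hy))
  linarith

end Duality

/-- A unitarily invariant norm on `M_n`: a norm with `‖U A V‖ = ‖A‖` for all unitary `U`, `V`. -/
structure UnitarilyInvariantNorm (n : ℕ) extends Seminorm ℂ (Matrix (Fin n) (Fin n) ℂ) where
  eq_zero_of_map_eq_zero : ∀ A, toSeminorm A = 0 → A = 0
  map_unitary_mul_mul : ∀ U ∈ Matrix.unitaryGroup (Fin n) ℂ, ∀ V ∈ Matrix.unitaryGroup (Fin n) ℂ,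
    ∀ A, toSeminorm (U * A * V) = toSeminorm A

/-- The trace norm `‖A‖₁ = tr |A|`, i.e. the norm of `S_1^n`. -/
def traceNorm {n : ℕ} (A : Matrix (Fin n) (Fin n) ℂ) : ℝ := (CFC.abs A).trace.re

namespace UnitarilyInvariantNorm

variable {n : ℕ} (X : UnitarilyInvariantNorm n)

/-- The space `M_n`, to be normed by `X`. -/
def Space (_X : UnitarilyInvariantNorm n) : Type := Matrix (Fin n) (Fin n) ℂ

instance : AddCommGroup X.Space := inferInstanceAs (AddCommGroup (Matrix (Fin n) (Fin n) ℂ))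

instance : Module ℂ X.Space := inferInstanceAs (Module ℂ (Matrix (Fin n) (Fin n) ℂ))

/-- The identity map from `M_n` to the space `(M_n, X)`. -/
def toSpace : Matrix (Fin n) (Fin n) ℂ ≃ₗ[ℂ] X.Space := LinearEquiv.refl ℂ _

instance : NormedAddCommGroup X.Space :=
  AddGroupNorm.toNormedAddCommGroup
    { toFun := fun A => X.toSeminorm (X.toSpace.symm A)
      map_zero' := by simp
      add_le' := fun A B => by rw [map_add]; exact map_add_le_add _ _ _
      neg' := fun A => by rw [map_neg, map_neg_eq_map]
      eq_zero_of_map_eq_zero' := fun A h => by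
        simpa using X.eq_zero_of_map_eq_zero _ h }

theorem norm_toSpace (A : Matrix (Fin n) (Fin n) ℂ) : ‖X.toSpace A‖ = X.toSeminorm A := rfl

instance : NormedSpace ℂ X.Space where
  norm_smul_le c A := by
    change X.toSeminorm (X.toSpace.symm (c • A)) ≤ ‖c‖ * X.toSeminorm (X.toSpace.symm A)
    rw [map_smul, map_smul_eq_mul]

/-- The matrix representing a functional on `(M_n, X)` under trace duality: the unique `B` such that
`φ A = tr (B A)` for all `A`. -/
def traceDual (φ : StrongDual ℂ X.Space) : Matrix (Fin n) (Fin n) ℂ :=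
  Matrix.of fun i j => φ (X.toSpace (Matrix.single j i 1))

theorem trace_traceDual_mul (φ : StrongDual ℂ X.Space) (A : Matrix (Fin n) (Fin n) ℂ) :
    (X.traceDual φ * A).trace = φ (X.toSpace A) := by
  conv_rhs => rw [Matrix.matrix_eq_sum_single A]
  simp only [map_sum, Matrix.trace, Matrix.diag_apply, Matrix.mul_apply, traceDual,
    Matrix.of_apply]
  rw [Finset.sum_comm]
  refine Finset.sum_congr rfl fun i _ => Finset.sum_congr rfl fun j _ => ?_
  have : Matrix.single i j (A i j) = A i j • Matrix.single i j (1 : ℂ) := by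
    simp [Matrix.smul_single]
  rw [this, map_smul, map_smul, smul_eq_mul, mul_comm]

/-- The duality map `J_X`, with `X*` identified with `M_n` through trace duality. -/
def J (A : Matrix (Fin n) (Fin n) ℂ) : Matrix (Fin n) (Fin n) ℂ :=
  X.traceDual (dualityMap (X.toSpace A))

/-- The map `G(A) = |J_X(A)| A`, where `|B| = (B* B)^(1/2)`. -/
def G (A : Matrix (Fin n) (Fin n) ℂ) : Matrix (Fin n) (Fin n) ℂ :=
  CFC.abs (X.J A) * A

end UnitarilyInvariantNorm

end

/-! Smoothness makes norming functionals unique, so J(WAV) = V* J(A) W* for unitary W, V, and hence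
G(WA) = W G(A). If C ≥ 0 has norm 1, then |J(C)| also norms C (Cauchy–Schwarz,
`DualBall.norm_trace_mul_sq_le`), so J(C) = |J(C)| ≥ 0. By equivariance J(C) commutes with C. So
G(C) = J(C) C is a state, which is (b).

For (a), left equivariance allows A ≥ 0. Write B = W|B|. Then P = J(B) B is a state, G(B) = W P, and
G(A) - G(B) = (J(A) - J(B)) A + J(B) (A - B) + (P - W P). Uniform continuity of J controls the first
term and duality the second. For the third, Cauchy–Schwarz gives tr G(B) ≥ 1 - 3‖A - B‖, and a state
P with tr(W P) near 1 is nearly fixed by W. -/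

/-! ### Polar decomposition and Cauchy–Schwarz for traces -/

namespace Matrix

variable {n : ℕ}

/-- Matrices with the same Gram matrix differ by a unitary factor on the left. -/
theorem exists_unitary_mul_eq_of_conjTranspose_mul_self_eq {A H : Matrix (Fin n) (Fin n) ℂ}
    (h : star A * A = star H * H) : ∃ W ∈ unitaryGroup (Fin n) ℂ, A = W * H := by
  let T := toEuclideanLin A
  let S := toEuclideanLin H
  have hgram : ∀ (B : Matrix (Fin n) (Fin n) ℂ) (x : EuclideanSpace ℂ (Fin n)),
      ((‖toEuclideanLin B x‖ ^ 2 : ℝ) : ℂ) = star x.ofLp ⬝ᵥ ((star B * B) *ᵥ x.ofLp) := by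
    intro B x
    have := inner_self_eq_norm_sq_to_K (𝕜 := ℂ) (toEuclideanLin B x)
    rw [EuclideanSpace.inner_eq_star_dotProduct] at this
    push_cast
    rw [← mulVec_mulVec, dotProduct_mulVec, star_eq_conjTranspose, ← star_mulVec,
      dotProduct_comm]
    exact this.symm
  have hnorm : ∀ x, ‖T x‖ = ‖S x‖ := by
    intro x
    have := (hgram A x).trans (h ▸ (hgram H x).symm)
    have h2 : ‖T x‖ ^ 2 = ‖S x‖ ^ 2 := by exact_mod_cast this
    exact (pow_left_inj₀ (norm_nonneg _) (norm_nonneg _) two_ne_zero).mp h2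
  -- The partial isometry S x ↦ T x is built from a linear section r of S. It extends to a unitary
  -- because the dimension is finite.
  obtain ⟨r, hr⟩ := S.rangeRestrict.exists_rightInverse_of_surjective S.range_rangeRestrict
  have hr' : ∀ y, S (r y) = y := fun y => congrArg Subtype.val (LinearMap.congr_fun hr y)
  let L : LinearMap.range S →ₗᵢ[ℂ] EuclideanSpace ℂ (Fin n) :=
    { toLinearMap := T ∘ₗ r
      norm_map' := fun y => by
        rw [LinearMap.comp_apply, hnorm, hr']; rfl }
  have hL : ∀ x, T x = L ⟨S x, x, rfl⟩ := by
    intro x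
    have : ‖T (x - r ⟨S x, x, rfl⟩)‖ = 0 := by rw [hnorm, map_sub, hr']; simp
    rw [norm_eq_zero, map_sub, sub_eq_zero] at this
    exact this
  let e := L.extend.toLinearIsometryEquiv rfl
  let b := EuclideanSpace.basisFun (Fin n) ℂ
  refine ⟨LinearMap.toMatrix b.toBasis b.toBasis e.toLinearEquiv.toLinearMap,
    e.toMatrix_mem_unitaryGroup b b, ?_⟩
  have key : T = e.toLinearEquiv.toLinearMap ∘ₗ S := by
    ext1 x
    exact (hL x).trans (L.extend_apply _).symm
  have := congrArg (LinearMap.toMatrix b.toBasis b.toBasis) key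
  rw [LinearMap.toMatrix_comp b.toBasis b.toBasis b.toBasis] at this
  have hT : ∀ B : Matrix (Fin n) (Fin n) ℂ,
      LinearMap.toMatrix b.toBasis b.toBasis (toEuclideanLin B) = B := by
    intro B
    rw [toEuclideanLin_eq_toLin_orthonormal, LinearMap.toMatrix_toLin]
  rwa [hT, hT] at this

/-- Polar decomposition. -/
theorem exists_unitary_mul_abs (A : Matrix (Fin n) (Fin n) ℂ) :
    ∃ W ∈ unitaryGroup (Fin n) ℂ, A = W * CFC.abs A := by
  refine exists_unitary_mul_eq_of_conjTranspose_mul_self_eq ?_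
  rw [(CFC.abs_nonneg A).isSelfAdjoint.star_eq, CFC.abs_mul_abs]

theorem abs_eq_of_mul_self {A H : Matrix (Fin n) (Fin n) ℂ} (hH : H.PosSemidef)
    (h : H * H = star A * A) : CFC.abs A = H :=
  CFC.sqrt_unique h hH.nonneg

theorem posSemidef_abs (A : Matrix (Fin n) (Fin n) ℂ) : (CFC.abs A).PosSemidef :=
  nonneg_iff_posSemidef.mp (CFC.abs_nonneg A)

theorem trace_mul_re_nonneg {H A : Matrix (Fin n) (Fin n) ℂ} (hH : H.PosSemidef)
    (hA : A.PosSemidef) : 0 ≤ (H * A).trace.re := by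
  obtain ⟨R, rfl⟩ := CStarAlgebra.nonneg_iff_eq_star_mul_self.mp hA.nonneg
  rw [← Matrix.mul_assoc, trace_mul_comm, ← Matrix.mul_assoc]
  exact (Complex.le_def.mp (hH.mul_mul_conjTranspose_same R).trace_nonneg).1

/-- Cauchy–Schwarz for the Hilbert–Schmidt inner product, by vectorizing matrices. -/
theorem norm_trace_conjTranspose_mul_sq_le (S T : Matrix (Fin n) (Fin n) ℂ) :
    ‖(Sᴴ * T).trace‖ ^ 2 ≤ (Sᴴ * S).trace.re * (Tᴴ * T).trace.re := by
  let v : Matrix (Fin n) (Fin n) ℂ → EuclideanSpace ℂ (Fin n × Fin n) :=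
    fun S => WithLp.toLp 2 fun p => S p.2 p.1
  have hv : ∀ S T, inner ℂ (v S) (v T) = (Sᴴ * T).trace := by
    intro S T
    simp [v, PiLp.inner_apply, Fintype.sum_prod_type, trace, mul_apply, mul_comm]
  have h := norm_inner_le_norm (𝕜 := ℂ) (v S) (v T)
  rw [← hv, ← hv, ← hv]
  have h1 := inner_self_eq_norm_sq (𝕜 := ℂ) (v S)
  have h2 := inner_self_eq_norm_sq (𝕜 := ℂ) (v T)
  simp only [RCLike.re_eq_complex_re] at h1 h2
  rw [h1, h2, ← mul_pow]
  gcongr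

/-- Cauchy–Schwarz for the form `(S, T) ↦ tr (S P T)` given by a positive semidefinite `P`. -/
theorem PosSemidef.norm_trace_mul_mul_sq_le {P : Matrix (Fin n) (Fin n) ℂ} (hP : P.PosSemidef)
    (S T : Matrix (Fin n) (Fin n) ℂ) :
    ‖(S * P * T).trace‖ ^ 2 ≤ (S * P * Sᴴ).trace.re * (Tᴴ * P * T).trace.re := by
  obtain ⟨R, rfl⟩ := CStarAlgebra.nonneg_iff_eq_star_mul_self.mp hP.nonneg
  have := norm_trace_conjTranspose_mul_sq_le (R * Sᴴ) (R * T)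
  simpa [star_eq_conjTranspose, Matrix.mul_assoc] using this

end Matrix

/-! ### Trace norm and commutation through unitaries -/

namespace Matrix

variable {n : ℕ}

theorem abs_mul_star_unitary (A : Matrix (Fin n) (Fin n) ℂ) {W : Matrix (Fin n) (Fin n) ℂ}
    (hW : W ∈ unitaryGroup (Fin n) ℂ) : CFC.abs (A * star W) = W * CFC.abs A * star W := by
  refine abs_eq_of_mul_self ((posSemidef_abs A).mul_mul_conjTranspose_same W) ?_
  calc W * CFC.abs A * star W * (W * CFC.abs A * star W)
      = W * CFC.abs A * (star W * W) * CFC.abs A * star W := by simp only [Matrix.mul_assoc]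
    _ = W * (CFC.abs A * CFC.abs A) * star W := by
      rw [mem_unitaryGroup_iff'.mp hW]; simp only [Matrix.mul_assoc, Matrix.one_mul]
    _ = star (A * star W) * (A * star W) := by
      rw [CFC.abs_mul_abs, star_mul, star_star]; simp only [Matrix.mul_assoc]

theorem PosSemidef.mul_of_commute {M C : Matrix (Fin n) (Fin n) ℂ} (hM : M.PosSemidef)
    (hC : C.PosSemidef) (h : M * C = C * M) : (M * C).PosSemidef :=
  nonneg_iff_posSemidef.mp (Commute.mul_nonneg hM.nonneg hC.nonneg h)

/-- The trace norm is attained by pairing with a unitary. -/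
theorem exists_unitary_traceNorm_eq (Y : Matrix (Fin n) (Fin n) ℂ) :
    ∃ V ∈ unitaryGroup (Fin n) ℂ, traceNorm Y = (V * Y).trace.re := by
  obtain ⟨W, hW, h⟩ := exists_unitary_mul_abs Y
  refine ⟨star W, Unitary.star_mem hW, ?_⟩
  have : star W * Y = CFC.abs Y := by
    conv_lhs => rw [h]
    rw [← Matrix.mul_assoc, mem_unitaryGroup_iff'.mp hW, Matrix.one_mul]
  rw [this, traceNorm]

/-- The Cayley transform `1 - 2i (C + i)⁻¹` of a Hermitian `C` is unitary, so a matrix commuting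
with all unitaries that commute with `C` commutes with `C`. -/
theorem IsHermitian.commute_of_forall_unitary {C M : Matrix (Fin n) (Fin n) ℂ}
    (hC : C.IsHermitian)
    (h : ∀ V ∈ unitaryGroup (Fin n) ℂ, V * C = C * V → V * M = M * V) : M * C = C * M := by
  set P := C + Complex.I • (1 : Matrix (Fin n) (Fin n) ℂ) with hP
  set Q := C + (-Complex.I) • (1 : Matrix (Fin n) (Fin n) ℂ) with hQ
  have hPQ : P * Q = Q * P := by
    simp only [hP, hQ, Matrix.add_mul, Matrix.mul_add, Matrix.smul_mul, Matrix.mul_smul,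
      Matrix.one_mul, Matrix.mul_one]
    module
  have hPs : star P = Q := by
    simp [hP, hQ, star_eq_conjTranspose, hC.eq]
  -- Q P = 1 + C² is positive definite, so both factors are invertible.
  have hu : IsUnit (Q * P).det := by
    have h1 : Q * P = 1 + star C * C := by
      rw [star_eq_conjTranspose, hC.eq]
      simp only [hP, hQ, Matrix.add_mul, Matrix.mul_add, Matrix.smul_mul, Matrix.mul_smul,
        Matrix.one_mul, Matrix.mul_one]
      match_scalars <;> ring_nf <;> simp
    rw [h1]
    exact (isUnit_iff_isUnit_det _).mp
      (PosDef.one.add_posSemidef (posSemidef_conjTranspose_mul_self C)).isUnit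
  rw [det_mul] at hu
  have hPu : IsUnit P.det := isUnit_of_mul_isUnit_right hu
  have hQu : IsUnit Q.det := isUnit_of_mul_isUnit_left hu
  have hQs : star Q = P := by rw [← hPs, star_star]
  have hPC : P * C = C * P := by
    simp [hP, Matrix.add_mul, Matrix.mul_add]
  have hiC : P⁻¹ * C = C * P⁻¹ := by
    calc P⁻¹ * C = P⁻¹ * (C * P) * P⁻¹ := by
          rw [Matrix.mul_assoc, Matrix.mul_assoc, mul_nonsing_inv _ hPu, Matrix.mul_one]
      _ = C * P⁻¹ := by
          rw [← hPC, ← Matrix.mul_assoc, nonsing_inv_mul _ hPu, Matrix.one_mul]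
  have hV : Q * P⁻¹ ∈ unitaryGroup (Fin n) ℂ := by
    rw [mem_unitaryGroup_iff', star_mul, hQs, star_eq_conjTranspose, conjTranspose_nonsing_inv,
      ← star_eq_conjTranspose, hPs]
    calc Q⁻¹ * P * (Q * P⁻¹) = Q⁻¹ * (P * Q) * P⁻¹ := by simp only [Matrix.mul_assoc]
      _ = (Q⁻¹ * Q) * (P * P⁻¹) := by rw [hPQ]; simp only [Matrix.mul_assoc]
      _ = 1 := by rw [nonsing_inv_mul _ hQu, mul_nonsing_inv _ hPu, Matrix.one_mul]
  have hQP : Q = P - (2 * Complex.I) • (1 : Matrix (Fin n) (Fin n) ℂ) := by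
    rw [hP, hQ]; module
  have hVe : Q * P⁻¹ = 1 - (2 * Complex.I) • P⁻¹ := by
    rw [hQP, Matrix.sub_mul, mul_nonsing_inv _ hPu, Matrix.smul_mul, Matrix.one_mul]
  have hM := h _ hV (by
    rw [hVe, Matrix.sub_mul, Matrix.mul_sub, Matrix.smul_mul, Matrix.mul_smul, hiC,
      Matrix.one_mul, Matrix.mul_one])
  rw [hVe, Matrix.sub_mul, Matrix.mul_sub, Matrix.smul_mul, Matrix.mul_smul,
    Matrix.one_mul, Matrix.mul_one, sub_right_inj] at hM
  have hM' : P⁻¹ * M = M * P⁻¹ := smul_right_injective _ (by simp) hM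
  have hMP : M * P = P * M := by
    calc M * P = P * (P⁻¹ * M) * P := by
          rw [← Matrix.mul_assoc, mul_nonsing_inv _ hPu, Matrix.one_mul]
      _ = P * M := by
          rw [hM', Matrix.mul_assoc, Matrix.mul_assoc, nonsing_inv_mul _ hPu, Matrix.mul_one]
  simpa [hP, Matrix.add_mul, Matrix.mul_add] using hMP

end Matrix

/-! ### The dual ball, equivariance and positivity of the duality map -/

namespace UnitarilyInvariantNorm

open Matrix

variable {n : ℕ} (X : UnitarilyInvariantNorm n)

theorem map_unitary_mul {W : Matrix (Fin n) (Fin n) ℂ} (hW : W ∈ unitaryGroup (Fin n) ℂ)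
    (A : Matrix (Fin n) (Fin n) ℂ) : X.toSeminorm (W * A) = X.toSeminorm A := by
  simpa using X.map_unitary_mul_mul W hW 1 (one_mem _) A

theorem map_mul_unitary {W : Matrix (Fin n) (Fin n) ℂ} (hW : W ∈ unitaryGroup (Fin n) ℂ)
    (A : Matrix (Fin n) (Fin n) ℂ) : X.toSeminorm (A * W) = X.toSeminorm A := by
  simpa using X.map_unitary_mul_mul 1 (one_mem _) W hW A

/-- The matrices in the dual unit ball of `(M_n, X)`, under trace duality. -/
def DualBall (K : Matrix (Fin n) (Fin n) ℂ) : Prop :=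
  ∀ Z, ‖(K * Z).trace‖ ≤ X.toSeminorm Z

variable {X}

theorem DualBall.unitary_mul_mul {K V W : Matrix (Fin n) (Fin n) ℂ} (hK : X.DualBall K)
    (hV : V ∈ unitaryGroup (Fin n) ℂ) (hW : W ∈ unitaryGroup (Fin n) ℂ) :
    X.DualBall (V * K * W) := by
  intro Z
  rw [Matrix.mul_assoc, trace_mul_comm, ← Matrix.mul_assoc, trace_mul_comm]
  rw [← X.map_unitary_mul_mul W hW V hV Z]
  exact hK _

theorem DualBall.re_trace_mul_le {K : Matrix (Fin n) (Fin n) ℂ} (hK : X.DualBall K)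
    (Z : Matrix (Fin n) (Fin n) ℂ) : (K * Z).trace.re ≤ X.toSeminorm Z :=
  (Complex.re_le_norm _).trans (hK Z)

theorem DualBall.unitary_mul {K V : Matrix (Fin n) (Fin n) ℂ} (hK : X.DualBall K)
    (hV : V ∈ unitaryGroup (Fin n) ℂ) : X.DualBall (V * K) := by
  simpa using hK.unitary_mul_mul hV (one_mem _)

theorem DualBall.abs {K : Matrix (Fin n) (Fin n) ℂ} (hK : X.DualBall K) :
    X.DualBall (CFC.abs K) := by
  obtain ⟨W, hW, h⟩ := exists_unitary_mul_abs K
  have : CFC.abs K = star W * K := by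
    conv_rhs => rw [h]
    rw [← Matrix.mul_assoc, mem_unitaryGroup_iff'.mp hW, Matrix.one_mul]
  rw [this]
  exact hK.unitary_mul (Unitary.star_mem hW)

/-- With L = W|L| and A = R*R, tr(LA) = tr(RW |L| R*). Cauchy–Schwarz for |L| bounds its square by
tr(W|L|W* A) · tr(|L|A), and the first factor is at most 1 because W|L|W* lies in the dual ball. -/
theorem DualBall.norm_trace_mul_sq_le {L A : Matrix (Fin n) (Fin n) ℂ} (hL : X.DualBall L)
    (hA : A.PosSemidef) (hA1 : X.toSeminorm A = 1) :
    ‖(L * A).trace‖ ^ 2 ≤ (CFC.abs L * A).trace.re := by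
  obtain ⟨W, hW, h⟩ := exists_unitary_mul_abs L
  obtain ⟨R, hR⟩ := CStarAlgebra.nonneg_iff_eq_star_mul_self.mp hA.nonneg
  rw [star_eq_conjTranspose] at hR
  have h1 := (posSemidef_abs L).norm_trace_mul_mul_sq_le (R * W) Rᴴ
  have e1 : (R * W * CFC.abs L * Rᴴ).trace = (L * A).trace := by
    rw [Matrix.mul_assoc R W, ← h, Matrix.mul_assoc, trace_mul_comm, Matrix.mul_assoc, hR]
  have e2 : (R * W * CFC.abs L * (R * W)ᴴ).trace = (W * CFC.abs L * star W * A).trace := by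
    rw [hR, conjTranspose_mul, ← star_eq_conjTranspose W]
    simp only [Matrix.mul_assoc]
    rw [trace_mul_comm R]
    simp only [Matrix.mul_assoc]
  have e3 : (Rᴴᴴ * CFC.abs L * Rᴴ).trace = (CFC.abs L * A).trace := by
    rw [conjTranspose_conjTranspose, Matrix.mul_assoc, trace_mul_comm, hR, Matrix.mul_assoc]
  rw [e1, e2, e3] at h1
  have h2 : (W * CFC.abs L * star W * A).trace.re ≤ 1 :=
    hA1 ▸ (hL.abs.unitary_mul_mul hW (Unitary.star_mem hW)).re_trace_mul_le A
  have h3 := trace_mul_re_nonneg (posSemidef_abs L) hA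
  exact h1.trans (mul_le_of_le_one_left h3 h2)

variable (X)

theorem dualBall_J {A : Matrix (Fin n) (Fin n) ℂ} (hA : X.toSeminorm A = 1) :
    X.DualBall (X.J A) := by
  intro Z
  rw [J, trace_traceDual_mul]
  have h := (dualityMap (X.toSpace A)).le_opNorm (X.toSpace Z)
  rwa [(isDualityValue_dualityMap (X.toSpace A)).1, norm_toSpace, norm_toSpace, hA, one_mul] at h

theorem trace_J_mul_self {A : Matrix (Fin n) (Fin n) ℂ} (hA : X.toSeminorm A = 1) :
    (X.J A * A).trace = 1 := by
  rw [J, trace_traceDual_mul, (isDualityValue_dualityMap (X.toSpace A)).2, norm_toSpace, hA]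
  simp

variable {X}

/-- The functional of K has norm at most 1 on the dual ball and at least 1 because of its value at
A, so uniqueness applies. Smoothness enters the structural facts about J and G only here. -/
theorem DualBall.eq_J {K A : Matrix (Fin n) (Fin n) ℂ} (hX : UniformlySmooth X.Space)
    (hK : X.DualBall K) (hA : X.toSeminorm A = 1) (h : (K * A).trace = 1) : K = X.J A := by
  let f : X.Space →ₗ[ℂ] ℂ :=
    (traceLinearMap (Fin n) ℂ ℂ ∘ₗ LinearMap.mulLeft ℂ K) ∘ₗ X.toSpace.symm.toLinearMap
  have hf : ∀ Z, f (X.toSpace Z) = (K * Z).trace := fun Z => rfl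
  let φ : StrongDual ℂ X.Space := f.mkContinuous 1 fun Z => by
    rw [one_mul]; exact hK _
  have hφ : IsDualityValue (X.toSpace A) φ := by
    have h1 : φ (X.toSpace A) = 1 := (hf A).trans h
    have hn : ‖X.toSpace A‖ = 1 := hA
    refine ⟨?_, by rw [h1, hn]; simp⟩
    rw [hn]
    refine le_antisymm (f.mkContinuous_norm_le zero_le_one _) ?_
    have h2 := φ.le_opNorm (X.toSpace A)
    rwa [h1, hn, mul_one, norm_one] at h2
  rw [J, ← hφ.eq_dualityMap hX]
  ext i j
  change K i j = f (X.toSpace (Matrix.single j i 1))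
  rw [hf, trace_mul_comm]
  simp [trace_single_mul]

theorem J_unitary_mul_mul (hX : UniformlySmooth X.Space) {A V W : Matrix (Fin n) (Fin n) ℂ}
    (hA : X.toSeminorm A = 1) (hW : W ∈ unitaryGroup (Fin n) ℂ)
    (hV : V ∈ unitaryGroup (Fin n) ℂ) : X.J (W * A * V) = star V * X.J A * star W := by
  refine (DualBall.eq_J hX ((X.dualBall_J hA).unitary_mul_mul (Unitary.star_mem hV) (Unitary.star_mem hW))
    ((X.map_unitary_mul_mul W hW V hV A).trans hA) ?_).symm
  calc (star V * X.J A * star W * (W * A * V)).trace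
      = (star V * (X.J A * (star W * W) * A * V)).trace := by simp only [Matrix.mul_assoc]
    _ = (X.J A * A * (V * star V)).trace := by
      rw [mem_unitaryGroup_iff'.mp hW, trace_mul_comm]
      simp only [Matrix.mul_assoc, Matrix.one_mul]
    _ = 1 := by rw [mem_unitaryGroup_iff.mp hV, Matrix.mul_one, X.trace_J_mul_self hA]

theorem J_unitary_mul (hX : UniformlySmooth X.Space) {A W : Matrix (Fin n) (Fin n) ℂ}
    (hA : X.toSeminorm A = 1) (hW : W ∈ unitaryGroup (Fin n) ℂ) :
    X.J (W * A) = X.J A * star W := by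
  simpa using J_unitary_mul_mul hX hA hW (one_mem _)

theorem G_unitary_mul (hX : UniformlySmooth X.Space) {A W : Matrix (Fin n) (Fin n) ℂ}
    (hA : X.toSeminorm A = 1) (hW : W ∈ unitaryGroup (Fin n) ℂ) :
    X.G (W * A) = W * X.G A := by
  rw [G, G, J_unitary_mul hX hA hW, abs_mul_star_unitary _ hW]
  simp only [Matrix.mul_assoc]
  rw [← Matrix.mul_assoc (star W), mem_unitaryGroup_iff'.mp hW, Matrix.one_mul]

theorem posSemidef_J (hX : UniformlySmooth X.Space) {C : Matrix (Fin n) (Fin n) ℂ}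
    (hC : C.PosSemidef) (hC1 : X.toSeminorm C = 1) : (X.J C).PosSemidef := by
  have hJ := X.dualBall_J hC1
  have h1 := hJ.norm_trace_mul_sq_le hC hC1
  rw [X.trace_J_mul_self hC1, norm_one, one_pow] at h1
  have h2 := hC1 ▸ hJ.abs C
  -- The trace has modulus at most 1 and real part at least 1, hence equals 1.
  have h3 : (CFC.abs (X.J C) * C).trace.re = ‖(CFC.abs (X.J C) * C).trace‖ :=
    le_antisymm (Complex.re_le_norm _) (h2.trans h1)
  have h4 : (CFC.abs (X.J C) * C).trace = 1 := by
    rw [Complex.re_eq_norm] at h3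
    have := Complex.eq_re_of_ofReal_le (r := 0) h3
    rw [this, le_antisymm ((Complex.re_le_norm _).trans h2) h1, Complex.ofReal_one]
  rw [← hJ.abs.eq_J hX hC1 h4]
  exact posSemidef_abs _

theorem J_mul_comm (hX : UniformlySmooth X.Space) {C : Matrix (Fin n) (Fin n) ℂ}
    (hC : C.PosSemidef) (hC1 : X.toSeminorm C = 1) : X.J C * C = C * X.J C := by
  -- If V commutes with C then V C V* = C, so equivariance gives J(C) = V J(C) V*.
  refine hC.1.commute_of_forall_unitary fun V hV hVC => ?_
  have h := J_unitary_mul_mul hX hC1 hV (Unitary.star_mem hV)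
  rw [hVC, Matrix.mul_assoc, mem_unitaryGroup_iff.mp hV, Matrix.mul_one, star_star] at h
  conv_rhs => rw [h]
  rw [Matrix.mul_assoc, mem_unitaryGroup_iff'.mp hV, Matrix.mul_one]

theorem G_of_posSemidef (hX : UniformlySmooth X.Space) {C : Matrix (Fin n) (Fin n) ℂ}
    (hC : C.PosSemidef) (hC1 : X.toSeminorm C = 1) : X.G C = X.J C * C := by
  rw [G, CFC.abs_of_nonneg _ (posSemidef_J hX hC hC1).nonneg]

theorem posSemidef_J_mul_self (hX : UniformlySmooth X.Space) {C : Matrix (Fin n) (Fin n) ℂ}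
    (hC : C.PosSemidef) (hC1 : X.toSeminorm C = 1) : (X.J C * C).PosSemidef :=
  (posSemidef_J hX hC hC1).mul_of_commute hC (J_mul_comm hX hC hC1)

theorem isState_G (hX : UniformlySmooth X.Space) {A : Matrix (Fin n) (Fin n) ℂ}
    (hA : A.PosSemidef) (hA1 : X.toSeminorm A = 1) :
    (X.G A).PosSemidef ∧ traceNorm (X.G A) = 1 ∧ (X.G A).trace = 1 := by
  have h := posSemidef_J_mul_self hX hA hA1
  rw [G_of_posSemidef hX hA hA1, traceNorm, CFC.abs_of_nonneg _ h.nonneg,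
    X.trace_J_mul_self hA1]
  exact ⟨h, by simp, rfl⟩

end UnitarilyInvariantNorm

/-! ### Quantitative estimates -/

namespace UnitarilyInvariantNorm

open Matrix

variable {n : ℕ} {X : UnitarilyInvariantNorm n}

theorem norm_trace_J_mul_ge {A B : Matrix (Fin n) (Fin n) ℂ} (hB : X.toSeminorm B = 1) :
    1 - X.toSeminorm (A - B) ≤ ‖(X.J B * A).trace‖ := by
  have h1 : (X.J B * A).trace = 1 + (X.J B * (A - B)).trace := by
    rw [Matrix.mul_sub, trace_sub, X.trace_J_mul_self hB]; ring
  have h2 := (neg_le_abs _).trans ((Complex.abs_re_le_norm _).trans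
    (X.dualBall_J hB (A - B)))
  have h3 := Complex.re_le_norm (X.J B * A).trace
  have h4 := congrArg Complex.re h1
  rw [Complex.add_re, Complex.one_re] at h4
  linarith

/-- For a positive semidefinite `A` near `B`, the trace of `G(B)` is nearly `1`. -/
theorem re_trace_G_ge {A B : Matrix (Fin n) (Fin n) ℂ} (hA : A.PosSemidef)
    (hA1 : X.toSeminorm A = 1) (hB : X.toSeminorm B = 1) :
    1 - 3 * X.toSeminorm (A - B) ≤ (X.G B).trace.re := by
  have hJ := X.dualBall_J hB
  have h1 := hJ.norm_trace_mul_sq_le hA hA1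
  have h2 := norm_trace_J_mul_ge (A := A) hB
  have h3 := hJ.abs.re_trace_mul_le (A - B)
  rw [Matrix.mul_sub, trace_sub, Complex.sub_re] at h3
  rw [G]
  -- With δ = ‖A - B‖ and x = |tr(J(B)A)| ≥ 1 - δ, x² ≥ 2x - 1 ≥ 1 - 2δ; replacing A by B in
  -- tr(|J(B)|A) costs one more δ.
  nlinarith [sq_nonneg (‖(X.J B * A).trace‖ - 1)]

/-- If `P` is a state and `W` is unitary with `tr (W P)` close to `1`, then `W P` is close to `P`
in trace norm. -/
theorem _root_.Matrix.PosSemidef.re_trace_unitary_sub_le {P V W : Matrix (Fin n) (Fin n) ℂ}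
    (hP : P.PosSemidef) (hP1 : P.trace = 1) (hV : V ∈ unitaryGroup (Fin n) ℂ)
    (hW : W ∈ unitaryGroup (Fin n) ℂ) :
    (V * (P - W * P)).trace.re ≤ √(2 - 2 * (W * P).trace.re) := by
  have h := hP.norm_trace_mul_mul_sq_le (1 - W) V
  have e1 : ((1 - W) * P * V).trace = (V * (P - W * P)).trace := by
    rw [trace_mul_comm, Matrix.sub_mul, Matrix.one_mul]
  have e2 : (Vᴴ * P * V).trace.re = 1 := by
    rw [trace_mul_comm, ← Matrix.mul_assoc, ← star_eq_conjTranspose,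
      mem_unitaryGroup_iff.mp hV, Matrix.one_mul, hP1, Complex.one_re]
  have e3 : ((1 - W) * P * (1 - W)ᴴ).trace.re = 2 - 2 * (W * P).trace.re := by
    have e4 : (P * Wᴴ).trace = star (W * P).trace := by
      rw [← trace_conjTranspose, conjTranspose_mul, hP.1.eq]
    have e5 : (W * P * Wᴴ).trace = 1 := by
      rw [trace_mul_comm, ← Matrix.mul_assoc, ← star_eq_conjTranspose,
        mem_unitaryGroup_iff'.mp hW, Matrix.one_mul, hP1]
    simp only [conjTranspose_sub, conjTranspose_one, Matrix.sub_mul, Matrix.mul_sub,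
      Matrix.one_mul, Matrix.mul_one, trace_sub, Complex.sub_re, e4, e5, hP1]
    simp
    ring
  rw [e1, e2, e3, mul_one] at h
  exact (Complex.re_le_norm _).trans (Real.le_sqrt_of_sq_le h)

theorem traceNorm_G_sub_le_of_posSemidef (hX : UniformlySmooth X.Space)
    {A B : Matrix (Fin n) (Fin n) ℂ} (hA : A.PosSemidef) (hA1 : X.toSeminorm A = 1)
    (hB : X.toSeminorm B = 1) {η : ℝ}
    (hη : ∀ Z, X.toSeminorm Z = 1 → ((X.J A - X.J B) * Z).trace.re ≤ η) :
    traceNorm (X.G A - X.G B) ≤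
      η + X.toSeminorm (A - B) + √(6 * X.toSeminorm (A - B)) := by
  obtain ⟨V, hV, hVY⟩ := exists_unitary_traceNorm_eq (X.G A - X.G B)
  obtain ⟨W, hW, hWC⟩ := exists_unitary_mul_abs B
  have hC := posSemidef_abs B
  have hC1 : X.toSeminorm (CFC.abs B) = 1 := by
    rw [← X.map_unitary_mul hW, ← hWC, hB]
  have hGB : X.G B = W * (X.J B * B) := by
    conv_lhs => rw [hWC]
    rw [G_unitary_mul hX hC1 hW, G_of_posSemidef hX hC hC1]
    conv_rhs => rw [hWC, J_unitary_mul hX hC1 hW]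
    rw [Matrix.mul_assoc _ (star W), ← Matrix.mul_assoc (star W),
      mem_unitaryGroup_iff'.mp hW, Matrix.one_mul]
  have hP : (X.J B * B).PosSemidef := by
    rw [hWC, J_unitary_mul hX hC1 hW, Matrix.mul_assoc, ← Matrix.mul_assoc (star W),
      mem_unitaryGroup_iff'.mp hW, Matrix.one_mul]
    exact posSemidef_J_mul_self hX hC hC1
  have hP1 := X.trace_J_mul_self hB
  have h1 := hP.re_trace_unitary_sub_le hP1 hV hW
  rw [← hGB] at h1
  have h2 : √(2 - 2 * (X.G B).trace.re) ≤ √(6 * X.toSeminorm (A - B)) :=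
    Real.sqrt_le_sqrt (by linarith [re_trace_G_ge hA hA1 hB])
  have h3 := hη (A * V) (by rw [X.map_mul_unitary hV, hA1])
  have h4 := ((X.dualBall_J hB).unitary_mul hV).re_trace_mul_le (A - B)
  -- The three-term splitting, tested against the unitary V that attains the trace norm.
  have h5 : (V * (X.G A - X.G B)).trace = ((X.J A - X.J B) * (A * V)).trace +
      (V * X.J B * (A - B)).trace + (V * (X.J B * B - X.G B)).trace := by
    rw [← Matrix.mul_assoc _ A V, trace_mul_comm _ V, ← trace_add, ← trace_add,
      G_of_posSemidef hX hA hA1]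
    congr 1
    noncomm_ring
  rw [hVY, h5, Complex.add_re, Complex.add_re]
  linarith

/-- Reduces to A ≥ 0 by multiplying both matrices on the left by U*, where A = U|A|. The bound on J
is therefore assumed for every pair at the same distance. -/
theorem traceNorm_G_sub_le (hX : UniformlySmooth X.Space)
    {A B : Matrix (Fin n) (Fin n) ℂ} (hA : X.toSeminorm A = 1) (hB : X.toSeminorm B = 1) {η : ℝ}
    (hη : ∀ A' B' Z, X.toSeminorm A' = 1 → X.toSeminorm B' = 1 →
      X.toSeminorm (A' - B') = X.toSeminorm (A - B) → X.toSeminorm Z = 1 →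
      ((X.J A' - X.J B') * Z).trace.re ≤ η) :
    traceNorm (X.G A - X.G B) ≤
      η + X.toSeminorm (A - B) + √(6 * X.toSeminorm (A - B)) := by
  obtain ⟨U, hU, hUA⟩ := exists_unitary_mul_abs A
  have hU' := Unitary.star_mem hU
  have hA' : CFC.abs A = star U * A := by
    conv_rhs => rw [hUA]
    rw [← Matrix.mul_assoc, mem_unitaryGroup_iff'.mp hU, Matrix.one_mul]
  have hA1 : X.toSeminorm (star U * A) = 1 := by rw [X.map_unitary_mul hU', hA]
  have hB1 : X.toSeminorm (star U * B) = 1 := by rw [X.map_unitary_mul hU', hB]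
  have hd : X.toSeminorm (star U * A - star U * B) = X.toSeminorm (A - B) := by
    rw [← Matrix.mul_sub, X.map_unitary_mul hU']
  have h := traceNorm_G_sub_le_of_posSemidef hX (hA' ▸ posSemidef_abs A) hA1 hB1
    (fun Z hZ => hη _ _ Z hA1 hB1 hd hZ)
  rw [hd, G_unitary_mul hX hA hU', G_unitary_mul hX hB hU', ← Matrix.mul_sub] at h
  have habs : CFC.abs (star U * (X.G A - X.G B)) = CFC.abs (X.G A - X.G B) := by
    rw [CFC.abs, CFC.abs, star_mul, star_star, Matrix.mul_assoc, ← Matrix.mul_assoc U,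
      mem_unitaryGroup_iff.mp hU, Matrix.one_mul]
  rwa [traceNorm, habs] at h

/-- Quantitative uniform continuity of the duality map. -/
theorem re_trace_J_sub_mul_le {A B Z : Matrix (Fin n) (Fin n) ℂ} (hA : X.toSeminorm A = 1)
    (hB : X.toSeminorm B = 1) (hZ : X.toSeminorm Z = 1) {τ r : ℝ} (hτ : 0 < τ)
    (hr : modulusOfSmoothness X.Space τ ≤ r) :
    ((X.J A - X.J B) * Z).trace.re ≤ (2 * r + X.toSeminorm (A - B)) / τ := by
  -- J(A) is tested on A + τZ and J(B) on A - τZ. The two norms sum to at most 2 + 2r, while Re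
  -- tr(J(B)A) ≥ 1 - ‖A - B‖.
  have h1 := (X.dualBall_J hA).re_trace_mul_le (A + (τ : ℂ) • Z)
  have h2 := (X.dualBall_J hB).re_trace_mul_le (A - (τ : ℂ) • Z)
  have h3 : (‖X.toSpace A + τ • X.toSpace Z‖ + ‖X.toSpace A - τ • X.toSpace Z‖) / 2 - 1 ≤ r :=
    (le_modulusOfSmoothness (E := X.Space) hA hZ τ).trans hr
  have e1 : ‖X.toSpace A + τ • X.toSpace Z‖ = X.toSeminorm (A + (τ : ℂ) • Z) := rfl
  have e2 : ‖X.toSpace A - τ • X.toSpace Z‖ = X.toSeminorm (A - (τ : ℂ) • Z) := rfl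
  have h4 := (X.dualBall_J hB).re_trace_mul_le (B - A)
  rw [map_sub_rev X.toSeminorm] at h4
  have h5 := X.trace_J_mul_self hA
  have h6 := X.trace_J_mul_self hB
  rw [e1, e2] at h3
  rw [Matrix.mul_add, trace_add, h5, Matrix.mul_smul, trace_smul, smul_eq_mul, Complex.add_re,
    Complex.re_ofReal_mul, Complex.one_re] at h1
  rw [Matrix.mul_sub, trace_sub, Matrix.mul_smul, trace_smul, smul_eq_mul, Complex.sub_re,
    Complex.re_ofReal_mul] at h2
  rw [Matrix.mul_sub, trace_sub, h6, Complex.sub_re, Complex.one_re] at h4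
  rw [le_div_iff₀ hτ, Matrix.sub_mul, trace_sub, Complex.sub_re]
  linarith

end UnitarilyInvariantNorm

/-! ### The modulus of continuity and conclusion -/

/-- The choice τ = √t makes both ρ(τ)/τ and t/τ vanish in the limit. The filter `𝓝[≥] 0` contains
the point 0, so the limit also encodes ω(0) = 0. -/
theorem tendsto_modulus_G {ρ : ℝ → ℝ} (hρ : Tendsto (fun τ : ℝ => ρ τ / τ) (𝓝[>] 0) (𝓝 0)) :
    Tendsto (fun t : ℝ => (2 * ρ (√t) + t) / √t + t + √(6 * t)) (𝓝[≥] 0) (𝓝 0) := by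
  have h0 : Tendsto (fun τ : ℝ => ρ τ / τ) (𝓝[≥] 0) (𝓝 0) := by
    rw [← Set.Ioi_insert, nhdsWithin_insert]
    refine tendsto_sup.mpr ⟨?_, hρ⟩
    -- At τ = 0 the quotient is 0 by the convention x / 0 = 0, whatever ρ(0) is.
    simpa using tendsto_pure_nhds (fun τ : ℝ => ρ τ / τ) 0
  have hs : Tendsto (fun t : ℝ => √t) (𝓝[≥] 0) (𝓝[≥] 0) := by
    refine tendsto_nhdsWithin_iff.mpr ⟨?_, Eventually.of_forall fun t => Real.sqrt_nonneg t⟩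
    have := (Real.continuous_sqrt.tendsto 0).mono_left (nhdsWithin_le_nhds (s := Set.Ici 0))
    rwa [Real.sqrt_zero] at this
  have h1 := (h0.comp hs).const_mul 2
  have hc : Continuous fun t : ℝ => √t + t + √(6 * t) := by fun_prop
  have h2 := (hc.tendsto 0).mono_left (nhdsWithin_le_nhds (s := Set.Ici 0))
  have h3 := h1.add h2
  simp only [mul_zero, Real.sqrt_zero, add_zero] at h3
  refine h3.congr fun t => ?_
  rw [add_div, Real.div_sqrt, mul_div_assoc]
  simp only [Function.comp_apply]
  ring

theorem mainTheorem7 :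
    (∀ ρ : ℝ → ℝ, Tendsto (fun τ : ℝ => ρ τ / τ) (𝓝[>] 0) (𝓝 0) →
      ∃ ω : ℝ → ℝ, Tendsto ω (𝓝[≥] 0) (𝓝 0) ∧
        ∀ (n : ℕ) (X : UnitarilyInvariantNorm n), UniformlySmooth X.Space →
          (∀ τ : ℝ, 0 < τ → modulusOfSmoothness X.Space τ ≤ ρ τ) →
          ∀ A B : Matrix (Fin n) (Fin n) ℂ, X.toSeminorm A = 1 → X.toSeminorm B = 1 →
            traceNorm (X.G A - X.G B) ≤ ω (X.toSeminorm (A - B))) ∧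
    (∀ (n : ℕ) (X : UnitarilyInvariantNorm n), UniformlySmooth X.Space →
      ∀ A : Matrix (Fin n) (Fin n) ℂ, A.PosSemidef → X.toSeminorm A = 1 →
        (X.G A).PosSemidef ∧ traceNorm (X.G A) = 1 ∧ (X.G A).trace = 1) := by

  refine ⟨fun ρ hρ => ⟨_, tendsto_modulus_G hρ, ?_⟩,
    fun n X hX A hA hA1 => UnitarilyInvariantNorm.isState_G hX hA hA1⟩
  intro n X hX hmod A B hA hB
  refine UnitarilyInvariantNorm.traceNorm_G_sub_le hX hA hB fun A' B' Z hA' hB' hd hZ => ?_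
  rw [← hd]
  -- At distance 0 the choice τ = √0 is not positive; there A' = B' and the bound reads 0 ≤ 0, again
  -- by division by zero.
  rcases (apply_nonneg X.toSeminorm (A' - B')).eq_or_lt with h0 | hpos
  · have h1 : A' = B' := sub_eq_zero.mp (X.eq_zero_of_map_eq_zero _ h0.symm)
    simp [h1]
  · exact UnitarilyInvariantNorm.re_trace_J_sub_mul_le hA' hB' hZ (Real.sqrt_pos.mpr hpos)
      (hmod _ (Real.sqrt_pos.mpr hpos))
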